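/- All polyhedra carry the metric topology: a polyhedron is a space homeomorphic to the geometric realization $|K|$ of some (not necessarily finite or locally finite) simplicial complex $K$, topologized by the metric $d(x,y)=\bigl(\sum_v (x_v-y_v)^2\bigr)^{1/2}$ in barycentric coordinates. An ANR is a metrizable space $Y$ such that, for every closed embedding of $Y$ in a metrizable space $Z$, the image of $Y$ is a retract of some neighborhood of it in $Z$. A metrizable space $M$ is called a coronated polyhedron (respectively, a coronated ANR) if it contains a compact subset $K$, possibly empty, such that $M\setminus K$ is a polyhedron (respectively, an ANR). The empty space counts as a polyhedron and as an ANR. **Theorem.** (a) Let $Q$ be a compact polyhedron. If $X\subset Q$ is locally compact (in the subspace topology), then $Q\setminus X$ is a coronated polyhedron. (b) Let $Q$ be a compact ANR. If $X\subset Q$ is locally compact (in the subspace topology), then $Q\setminus X$ is a coronated ANR. -/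

import Mathlib

universe u

/-- The geometric realization `|K|` of an abstract simplicial complex `K` with vertices in `V`, as
the set of families of barycentric coordinates `x : V → ℝ` (nonnegative, supported on a simplex
of `K`, of total sum `1`). As a subset of the Hilbert space `ℓ²(V)` it carries the metric topology
(not the weak topology), given by `d(x, y)² = ∑ v, (x v - y v)²`.
Elements of `V` that belong to no simplex do not contribute to `|K|`. -/
def simplicialRealization {V : Type u} (K : PreAbstractSimplicialComplex V) :
    Set (lp (fun _ : V => ℝ) 2) :=
  {x | (∀ v, 0 ≤ x v) ∧ ∃ s ∈ K.faces, (∀ v, v ∉ s → x v = 0) ∧ ∑ v ∈ s, x v = 1}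

/-- A polyhedron: a space homeomorphic to the realization, with the metric topology, of some
simplicial complex (no finiteness or local finiteness of the complex is required, and the empty
space is a polyhedron). -/
def IsPolyhedron (P : Type u) [TopologicalSpace P] : Prop :=
  ∃ (V : Type u) (K : PreAbstractSimplicialComplex V), Nonempty (P ≃ₜ simplicialRealization K)

/-- `A` is a neighborhood retract of `Z`: some open `U ⊇ A` admits a retraction `U → A`. -/
def IsNeighborhoodRetract {Z : Type u} [TopologicalSpace Z] (A : Set Z) : Prop :=
  ∃ U : Set Z, IsOpen U ∧ A ⊆ U ∧
    ∃ r : Z → Z, ContinuousOn r U ∧ Set.MapsTo r U A ∧ ∀ a ∈ A, r a = a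

/-- An ANR (absolute neighborhood retract for metrizable spaces): a metrizable space whose image
under every closed embedding in a metrizable space is a neighborhood retract there. -/
def IsANR (Y : Type u) [TopologicalSpace Y] : Prop :=
  TopologicalSpace.MetrizableSpace Y ∧
    ∀ (Z : Type u) [TopologicalSpace Z] [TopologicalSpace.MetrizableSpace Z] (e : Y → Z),
      Topology.IsClosedEmbedding e → IsNeighborhoodRetract (Set.range e)

/-- A coronated polyhedron: a metrizable space containing a compactum (possibly empty) whose
complement is a polyhedron. -/
def IsCoronatedPolyhedron (X : Type u) [TopologicalSpace X] : Prop :=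
  TopologicalSpace.MetrizableSpace X ∧ ∃ K : Set X, IsCompact K ∧ IsPolyhedron ↥(Kᶜ)

/-- A coronated ANR: a metrizable space containing a compactum (possibly empty) whose
complement is an ANR. -/
def IsCoronatedANR (X : Type u) [TopologicalSpace X] : Prop :=
  TopologicalSpace.MetrizableSpace X ∧ ∃ K : Set X, IsCompact K ∧ IsANR ↥(Kᶜ)

/-! A locally compact `X` is open in its closure, so `closure X \ X` is a compact part of `Q \ X`,
and removing it leaves `Q \ closure X`, which is open in `Q`. Both claims thus reduce to the fact
that open subspaces of compact polyhedra (ANRs) are again polyhedra (ANRs).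

For ANRs, `Q` sits in a countable product of lines as a neighborhood retract. Tietze's theorem
extends the map into this product from a closed copy of the open subspace; composing with the
retraction and keeping only the points that land in the open subspace gives the required retraction.

For polyhedra, `Q` becomes a subcomplex `P` of a finite-dimensional standard simplex and the
subspace a relatively open `W ⊆ P`. Around each point of `W` the coarsest dyadic grid is used for
which all closed cells at that point stay in `W`. Cells of different levels fit together because the
level cannot drop on passing to the frontier of a cell (`dyadicLevel_le`). Such a locally finite
convex decomposition is triangulated by chains of cells, each cell being coned from a chosen point
(`IsCellRelation.exists_isBary`, `IsCellRelation.IsBary.unique`); the resulting continuous bijection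
is proper, hence a homeomorphism for the metric topology. -/

open Topology

/-! ### Locally compact subsets and their closures -/

/-- A locally compact subset of a Hausdorff space is open in its closure. -/
theorem isClosed_closure_diff_of_locallyCompactSpace {Q : Type*} [TopologicalSpace Q] [T2Space Q]
    (X : Set Q) [LocallyCompactSpace X] : IsClosed (closure X \ X) := by
  rw [← isOpen_compl_iff, isOpen_iff_mem_nhds]
  intro x hx
  by_cases hxX : x ∈ X
  · obtain ⟨N, hN, hxN⟩ := exists_compact_mem_nhds (⟨x, hxX⟩ : X)
    rw [nhds_subtype_eq_comap, Filter.mem_comap] at hxN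
    obtain ⟨t, ht, htN⟩ := hxN
    obtain ⟨O, hOt, hO, hxO⟩ := mem_nhds_iff.1 ht
    have hNc : IsClosed ((↑) '' N : Set Q) := (hN.image continuous_subtype_val).isClosed
    -- Near `x`, points of `closure X` are limits of `O ∩ X`, which lies in a compact subset of `X`;
    -- so they belong to `X`.
    filter_upwards [hO.mem_nhds hxO] with y hy hyc
    have h1 : y ∈ closure (O ∩ X) := hO.inter_closure ⟨hy, hyc.1⟩
    have h2 : O ∩ X ⊆ ((↑) '' N : Set Q) := fun z hz => ⟨⟨z, hz.2⟩, htN (hOt hz.1), rfl⟩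
    obtain ⟨z, -, hz⟩ := closure_minimal h2 hNc h1
    exact hyc.2 (hz ▸ z.2)
  · have : x ∉ closure X := fun h => hx ⟨h, hxX⟩
    filter_upwards [isClosed_closure.isOpen_compl.mem_nhds this] with y hy hyc
    exact hy hyc.1

/-- The complement of a locally compact subset of a compact Hausdorff space is, up to a compact
set, an open subspace. -/
theorem exists_isCompact_isOpenEmbedding_compl {Q : Type*} [TopologicalSpace Q] [CompactSpace Q]
    [T2Space Q] (X : Set Q) [LocallyCompactSpace X] :
    ∃ K : Set ↥(Xᶜ), IsCompact K ∧ IsOpenEmbedding (fun z : ↥(Kᶜ) => (z : Q)) := by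
  refine ⟨(↑) ⁻¹' closure X, ?_, ?_, ?_⟩
  · rw [Subtype.isCompact_iff, Subtype.image_preimage_coe, Set.inter_comm, ← Set.sdiff_eq]
    exact (isClosed_closure_diff_of_locallyCompactSpace X).isCompact
  · exact IsEmbedding.subtypeVal.comp IsEmbedding.subtypeVal
  · convert (isClosed_closure (s := X)).isOpen_compl using 1
    ext x
    constructor
    · rintro ⟨z, rfl⟩
      exact z.2
    · intro hx
      exact ⟨⟨⟨x, fun h => hx (subset_closure h)⟩, hx⟩, rfl⟩

/-! ### Invariance of polyhedra, and open subspaces of compact ANRs -/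

theorem IsPolyhedron.metrizableSpace {P : Type u} [TopologicalSpace P] (h : IsPolyhedron P) :
    TopologicalSpace.MetrizableSpace P := by
  obtain ⟨V, K, ⟨e⟩⟩ := h
  exact e.isEmbedding.metrizableSpace

theorem IsPolyhedron.of_homeomorph {P P' : Type u} [TopologicalSpace P] [TopologicalSpace P']
    (h : IsPolyhedron P) (e : P' ≃ₜ P) : IsPolyhedron P' := by
  obtain ⟨V, K, ⟨e'⟩⟩ := h
  exact ⟨V, K, ⟨e.trans e'⟩⟩

/-- A compact metrizable space embeds in a countable power of the real line. -/
theorem exists_isClosedEmbedding_pi_real (Q : Type*) [TopologicalSpace Q] [CompactSpace Q]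
    [TopologicalSpace.MetrizableSpace Q] :
    ∃ i : Q → (ULift.{u} ℕ → ℝ), IsClosedEmbedding i := by
  let _ := TopologicalSpace.metrizableSpaceMetric Q
  obtain ⟨f, hf⟩ := TopologicalSpace.exists_embedding_l_infty Q
  -- Lifting the index puts the product in the universe over which `IsANR` quantifies. Compactness
  -- makes a continuous injection a closed embedding.
  refine ⟨fun q n => f q n.down, Continuous.isClosedEmbedding ?_ ?_⟩
  · refine continuous_pi fun n => ?_
    exact ((continuous_apply n.down).comp BoundedContinuousFunction.continuous_coe).comp hf.continuous
  · intro q q' h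
    apply hf.injective
    ext n
    exact congrFun h ⟨n⟩

/-- Open subspaces of compact ANRs are ANRs. -/
theorem IsANR.of_isOpenEmbedding {Q : Type u} [TopologicalSpace Q] [CompactSpace Q]
    (hQ : IsANR Q) {Y : Type u} [TopologicalSpace Y] {j : Y → Q} (hj : IsOpenEmbedding j) :
    IsANR Y := by
  obtain ⟨hQm, hQr⟩ := hQ
  refine ⟨hj.isEmbedding.metrizableSpace, fun Z _ _ e he => ?_⟩
  let _ := TopologicalSpace.metrizableSpaceMetric Z
  rcases isEmpty_or_nonempty Y with hY | hY
  · exact ⟨∅, isOpen_empty, (Set.range_eq_empty e).subset, id, continuousOn_id,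
      Set.mapsTo_empty _ _, fun _ _ => rfl⟩
  obtain ⟨i, hi⟩ := exists_isClosedEmbedding_pi_real.{u} Q
  obtain ⟨U, hU, hiU, r, hrc, hrU, hri⟩ := hQr _ i hi
  obtain ⟨F, hF⟩ := ContinuousMap.exists_extension' he
    (⟨i ∘ j, hi.continuous.comp hj.continuous⟩ : C(Y, ULift.{u} ℕ → ℝ))
  have hFe : ∀ y, F (e y) = i (j y) := fun y => congrFun hF y
  have hrFc : ContinuousOn (fun z => r (F z)) (F ⁻¹' U) :=
    hrc.comp F.continuous.continuousOn (Set.mapsTo_preimage _ _)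
  obtain ⟨O, hO, hOj⟩ := hi.isInducing.isOpen_iff.1 hj.isOpen_range
  -- `O` cuts `j(Y)` out of `Q`, so on this open set `r (F z)` lies in the copy of `Y`.
  have hopen : IsOpen (F ⁻¹' U ∩ (fun z => r (F z)) ⁻¹' O) :=
    hrFc.isOpen_inter_preimage (hU.preimage F.continuous) hO
  have hij : IsEmbedding (i ∘ j) := hi.isEmbedding.comp hj.isEmbedding
  have hrange : ∀ z ∈ F ⁻¹' U ∩ (fun z => r (F z)) ⁻¹' O, ∃ y, i (j y) = r (F z) := by
    rintro z ⟨hzU, hzO⟩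
    obtain ⟨q, hq⟩ := hrU hzU
    have : q ∈ i ⁻¹' O := by
      change i q ∈ O
      rw [hq]
      exact hzO
    rw [hOj] at this
    obtain ⟨y, rfl⟩ := this
    exact ⟨y, hq⟩
  choose! g hg using hrange
  have hge : ∀ y, g (e y) = y ∧ e y ∈ F ⁻¹' U ∩ (fun z => r (F z)) ⁻¹' O := by
    intro y
    have h1 : F (e y) ∈ U := hFe y ▸ hiU ⟨_, rfl⟩
    have h2 : r (F (e y)) = i (j y) := by rw [hFe]; exact hri _ ⟨_, rfl⟩
    have h3 : e y ∈ F ⁻¹' U ∩ (fun z => r (F z)) ⁻¹' O := by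
      refine ⟨h1, ?_⟩
      change r (F (e y)) ∈ O
      rw [h2]
      change j y ∈ i ⁻¹' O
      rw [hOj]
      exact ⟨y, rfl⟩
    exact ⟨hij.injective ((hg _ h3).trans h2), h3⟩
  refine ⟨_, hopen, ?_, fun z => e (g z), ?_, ?_, ?_⟩
  · rintro _ ⟨y, rfl⟩
    exact (hge y).2
  · refine he.continuous.comp_continuousOn ?_
    rw [hij.isInducing.continuousOn_iff]
    exact (hrFc.mono Set.inter_subset_left).congr hg
  · intro z _
    exact ⟨_, rfl⟩
  · rintro _ ⟨y, rfl⟩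
    exact congrArg e (hge y).1

/-! ### Convex cells and their radial structure -/

/-- A decomposition of `W` into relatively open convex cells, encoded by the relation `r x y`:
"`x` lies in the closure of the cell of `y`". Two points are in the same cell when they are
related both ways, and `V` is a set of representatives of the cells. -/
structure IsCellRelation {E : Type*} [NormedAddCommGroup E] [NormedSpace ℝ E]
    (W V : Set E) (r : E → E → Prop) : Prop where
  mem_left : ∀ {x y}, r x y → x ∈ W
  mem_right : ∀ {x y}, r x y → y ∈ W
  refl : ∀ {x}, x ∈ W → r x x
  trans : ∀ {x y z}, r x y → r y z → r x z
  convex : ∀ y, Convex ℝ {x | r x y}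
  isCompact : ∀ y ∈ W, IsCompact {x | r x y}
  segment : ∀ {x y} {t : ℝ}, r x y → 0 < t → t ≤ 1 → r y (t • y + (1 - t) • x)
  extend : ∀ {x y}, r x y → r y x → x ≠ y → ∃ ε : ℝ, 0 < ε ∧ r (x + ε • (x - y)) y
  subset : V ⊆ W
  exists_rep : ∀ {x}, x ∈ W → ∃ p ∈ V, r x p ∧ r p x
  antisymm : ∀ {p q}, p ∈ V → q ∈ V → r p q → r q p → p = q
  finite : ∀ x ∈ W, ∃ N ∈ 𝓝[W] x, {v | v ∈ V ∧ ∃ y ∈ N, r v y ∧ r y v}.Finite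

namespace IsCellRelation

variable {E : Type u} [NormedAddCommGroup E] [NormedSpace ℝ E] {W V : Set E} {r : E → E → Prop}

/-- The closed cell of `x` is compact, so by local finiteness it meets only finitely many cells. -/
theorem finite_below (h : IsCellRelation W V r) {x : E} (hx : x ∈ W) :
    {v | v ∈ V ∧ r v x}.Finite := by
  have key : {v | v ∈ V ∧ ∃ y ∈ {y | r y x}, r v y ∧ r y v}.Finite := by
    refine (h.isCompact x hx).induction_on
      (p := fun s => {v | v ∈ V ∧ ∃ y ∈ s, r v y ∧ r y v}.Finite) ?_ ?_ ?_ ?_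
    · simp
    · intro s t hst ht
      exact ht.subset fun v ⟨hv, y, hy, h1⟩ => ⟨hv, y, hst hy, h1⟩
    · intro s t hs ht
      refine (hs.union ht).subset ?_
      rintro v ⟨hv, y, hy | hy, h1⟩
      · exact Or.inl ⟨hv, y, hy, h1⟩
      · exact Or.inr ⟨hv, y, hy, h1⟩
    · intro y hy
      obtain ⟨N, hN, hf⟩ := h.finite y (h.mem_left hy)
      exact ⟨N, nhdsWithin_mono _ (fun z hz => h.mem_left hz) hN, hf⟩
  refine key.subset fun v hv => ⟨hv.1, v, hv.2, h.refl (h.mem_left hv.2), h.refl (h.mem_left hv.2)⟩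

theorem segment_mem (h : IsCellRelation W V r) {x y : E} {t : ℝ} (hxy : r x y) (h0 : 0 ≤ t)
    (h1 : t ≤ 1) : r (t • y + (1 - t) • x) y :=
  h.convex y (h.refl (h.mem_right hxy)) hxy h0 (by linarith) (by ring)

/-- Moving slightly from `x` towards `v` enters the cell of `v`, so that cell meets every
neighborhood of `x`. -/
theorem finite_above (h : IsCellRelation W V r) {x : E} (hx : x ∈ W) :
    {v | v ∈ V ∧ r x v}.Finite := by
  obtain ⟨N, hN, hf⟩ := h.finite x hx
  refine hf.subset ?_
  rintro v ⟨hv, hxv⟩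
  refine ⟨hv, ?_⟩
  have hc : Filter.Tendsto (fun t : ℝ => t • v + (1 - t) • x) (𝓝[>] 0) (𝓝 x) := by
    have : Continuous fun t : ℝ => t • v + (1 - t) • x := by fun_prop
    simpa using (this.tendsto 0).mono_left nhdsWithin_le_nhds
  have hev : ∀ᶠ t : ℝ in 𝓝[>] 0, 0 < t ∧ t ≤ 1 := by
    filter_upwards [Ioc_mem_nhdsGT (zero_lt_one' ℝ)] with t ht using ht
  have hW : Filter.Tendsto (fun t : ℝ => t • v + (1 - t) • x) (𝓝[>] 0) (𝓝[W] x) := by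
    refine tendsto_nhdsWithin_iff.2 ⟨hc, ?_⟩
    filter_upwards [hev] with t ht using h.mem_left (h.segment_mem hxv ht.1.le ht.2)
  obtain ⟨t, htN, ht⟩ := ((hW.eventually hN).and hev).exists
  exact ⟨_, htN, h.segment hxv ht.1 ht.2, h.segment_mem hxv ht.1.le ht.2⟩

/-- If `t < t'`, then `y` lies on the segment from `y'` to `p` and differs from `y'`, so `segment`
gives `r p y`. -/
theorem ray_unique_aux (h : IsCellRelation W V r) {p y y' : E} {t t' : ℝ}
    (hy : ¬ r p y) (hy' : r y' p) (ht' : t' < 1)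
    (he : t • p + (1 - t) • y = t' • p + (1 - t') • y') : t' ≤ t := by
  by_contra! hlt
  have h1 : 0 < 1 - t := by linarith
  apply hy
  have : y = ((t' - t) / (1 - t)) • p + (1 - (t' - t) / (1 - t)) • y' := by
    have h2 : (1 - t) • y = (t' - t) • p + (1 - t') • y' := by
      rw [sub_smul, ← sub_eq_zero] at *
      rw [← he]
      module
    have h3 : 1 - (t' - t) / (1 - t) = (1 - t') / (1 - t) := by field_simp; ring
    rw [h3, div_eq_inv_mul, div_eq_inv_mul, mul_smul, mul_smul, ← smul_add, ← h2, smul_smul,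
      inv_mul_cancel₀ h1.ne', one_smul]
  rw [this]
  exact h.segment hy' (div_pos (by linarith) h1) ((div_le_one h1).2 (by linarith))

theorem ray_unique (h : IsCellRelation W V r) {p y y' : E} {t t' : ℝ}
    (hy : r y p) (hyp : ¬ r p y) (hy' : r y' p) (hyp' : ¬ r p y') (ht : t < 1) (ht' : t' < 1)
    (he : t • p + (1 - t) • y = t' • p + (1 - t') • y') : t = t' ∧ y = y' := by
  obtain rfl : t = t' := le_antisymm (h.ray_unique_aux hyp' hy ht he.symm)
    (h.ray_unique_aux hyp hy' ht' he)
  refine ⟨rfl, ?_⟩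
  have h1 : (1 - t) ≠ 0 := by linarith
  exact smul_right_injective E h1 (add_left_cancel he)

/-- The ray from `p` through `x` leaves the compact closed cell at a last point `γ m`; by `extend`,
that point is outside the open cell. -/
theorem exists_ray (h : IsCellRelation W V r) {p x : E} (hxp : r x p) (hpx : r p x)
    (hne : x ≠ p) : ∃ (t : ℝ) (y : E), 0 < t ∧ t < 1 ∧ r y p ∧ ¬ r p y ∧
      x = t • p + (1 - t) • y := by
  have hp : p ∈ W := h.mem_left hpx
  have hxp0 : x - p ≠ 0 := sub_ne_zero.2 hne
  let γ : ℝ → E := fun s => p + s • (x - p)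
  have hγ : Continuous γ := by fun_prop
  let S : Set ℝ := {s | r (γ s) p}
  have h1S : (1 : ℝ) ∈ S := by simpa [S, γ] using hxp
  have hSc : IsClosed S := (h.isCompact p hp).isClosed.preimage hγ
  have hSb : BddAbove S := by
    obtain ⟨R, hR⟩ := (h.isCompact p hp).isBounded.subset_closedBall p
    refine ⟨R / ‖x - p‖, fun s hs => ?_⟩
    rw [le_div_iff₀ (norm_pos_iff.2 hxp0)]
    have := hR hs
    rw [mem_closedBall_iff_norm] at this
    simp only [γ, add_sub_cancel_left, norm_smul] at this
    exact (mul_le_mul_of_nonneg_right (le_abs_self s) (norm_nonneg _)).trans this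
  set m := sSup S with hm
  have hmS : m ∈ S := hSc.csSup_mem ⟨1, h1S⟩ hSb
  have hm1 : 1 ≤ m := le_csSup hSb h1S
  have hm0 : 0 < m := by linarith
  have hpy : ¬ r p (γ m) := by
    intro hpy
    have hne' : γ m ≠ p := by
      simp only [γ, ne_eq, add_eq_left, smul_eq_zero, not_or]
      exact ⟨hm0.ne', hxp0⟩
    obtain ⟨ε, hε, hr⟩ := h.extend hmS hpy hne'
    have : m + ε * m ∈ S := by
      change r (γ (m + ε * m)) p
      convert hr using 1
      simp only [γ]
      module
    have := le_csSup hSb this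
    nlinarith
  have hm1' : 1 < m := by
    refine lt_of_le_of_ne hm1 fun hm' => hpy ?_
    rw [← hm']
    simpa [γ] using hpx
  refine ⟨1 - m⁻¹, γ m, ?_, ?_, hmS, hpy, ?_⟩
  · have := inv_lt_one_of_one_lt₀ hm1'
    linarith
  · have := inv_pos.2 hm0
    linarith
  · have : (1 - (1 - m⁻¹)) • γ m = m⁻¹ • p + (x - p) := by
      simp only [γ, sub_sub_cancel, smul_add, smul_smul, inv_mul_cancel₀ hm0.ne', one_smul]
    rw [this]
    module

/-! ### Barycentric coordinates along chains of cells -/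

/-- The order complex of the cells: the simplices are the finite chains of representatives. -/
def orderComplex (V : Set E) (r : E → E → Prop) : PreAbstractSimplicialComplex V where
  faces := {s | s.Nonempty ∧ ∀ p ∈ s, ∀ q ∈ s, r p q ∨ r q p}
  isRelLowerSet_faces := fun _ hs => ⟨hs.1, fun _ hts ht =>
    ⟨ht, fun p hp q hq => hs.2 p (hts hp) q (hts hq)⟩⟩

/-- `x` is the convex combination with positive weights `a` of the finite chain `s`. -/
structure IsBary (r : E → E → Prop) (a : V → ℝ) (s : Finset V) (x : E) : Prop where
  mem : s ∈ (orderComplex V r).faces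
  pos : ∀ v ∈ s, 0 < a v
  zero : ∀ v ∉ s, a v = 0
  sum : ∑ v ∈ s, a v = 1
  sum_smul : ∑ v ∈ s, a v • (v : E) = x

theorem exists_top (h : IsCellRelation W V r) {s : Finset V}
    (hs : s ∈ (orderComplex V r).faces) : ∃ p ∈ s, ∀ v ∈ s, r (v : E) p := by
  classical
  obtain ⟨hne, hs⟩ := hs
  induction hne using Finset.Nonempty.cons_induction with
  | singleton a => exact ⟨a, by simp, by simpa using h.refl (h.subset a.2)⟩
  | cons a s ha hne ih =>
    obtain ⟨p, hp, hpv⟩ := ih fun p hp q hq => hs p (by simp [hp]) q (by simp [hq])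
    rcases hs a (by simp) p (by simp [hp]) with h1 | h1
    · refine ⟨p, by simp [hp], fun v hv => ?_⟩
      rcases Finset.mem_cons.1 hv with rfl | hv
      · exact h1
      · exact hpv v hv
    · refine ⟨a, by simp, fun v hv => ?_⟩
      rcases Finset.mem_cons.1 hv with rfl | hv
      · exact h.refl (h.subset v.2)
      · exact h.trans (hpv v hv) h1

-- Join decomposition: dividing the other weights by `1 - a p` gives a point of the face opposite
-- `p`. Inductions on chains rest on it.
open Classical in
theorem IsBary.cases {a : V → ℝ} {s : Finset V} {x : E}
    (hb : IsBary r a s x) {p : V} (hp : p ∈ s) :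
    (s = {p} ∧ a p = 1 ∧ x = p) ∨ (a p < 1 ∧ ∃ y : E,
      IsBary r (fun v => if v = p then 0 else (1 - a p)⁻¹ * a v) (s.erase p) y ∧
      x = a p • (p : E) + (1 - a p) • y) := by
  have hsum : a p + ∑ v ∈ s.erase p, a v = 1 := by
    rw [Finset.add_sum_erase _ _ hp, hb.sum]
  have hsm : a p • (p : E) + ∑ v ∈ s.erase p, a v • (v : E) = x := by
    rw [Finset.add_sum_erase _ (fun v => a v • (v : E)) hp, hb.sum_smul]
  rcases (s.erase p).eq_empty_or_nonempty with he | hne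
  · left
    rw [he] at hsum hsm
    simp only [Finset.sum_empty, add_zero] at hsum hsm
    rw [hsum, one_smul] at hsm
    rcases (Finset.erase_eq_empty_iff _ _).1 he with h1 | h1
    · simp [h1] at hp
    · exact ⟨h1, hsum, hsm.symm⟩
  · right
    have hpos : 0 < ∑ v ∈ s.erase p, a v :=
      Finset.sum_pos (fun v hv => hb.pos v (Finset.mem_of_mem_erase hv)) hne
    have hlt : a p < 1 := by linarith
    have h1 : 0 < 1 - a p := by linarith
    refine ⟨hlt, (1 - a p)⁻¹ • ∑ v ∈ s.erase p, a v • (v : E), ?_, ?_⟩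
    · refine ⟨⟨hne, fun v hv w hw => hb.mem.2 v (Finset.mem_of_mem_erase hv) w
        (Finset.mem_of_mem_erase hw)⟩, fun v hv => ?_, fun v hv => ?_, ?_, ?_⟩
      · rw [if_neg (Finset.ne_of_mem_erase hv)]
        exact mul_pos (inv_pos.2 h1) (hb.pos v (Finset.mem_of_mem_erase hv))
      · by_cases hvp : v = p
        · simp [hvp]
        · rw [if_neg hvp, hb.zero v fun hvs => hv (Finset.mem_erase.2 ⟨hvp, hvs⟩), mul_zero]
      · rw [Finset.sum_congr rfl fun v hv => if_neg (Finset.ne_of_mem_erase hv),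
          ← Finset.mul_sum, inv_mul_eq_one₀ h1.ne']
        linarith
      · rw [Finset.smul_sum]
        refine Finset.sum_congr rfl fun v hv => ?_
        rw [if_neg (Finset.ne_of_mem_erase hv), mul_smul]
    · rw [smul_smul, mul_inv_cancel₀ h1.ne', one_smul, hsm]

/-- A positive weight on the top vertex pulls the point into the open cell of that vertex, by
`segment`. -/
theorem IsBary.equiv_top (h : IsCellRelation W V r) {a : V → ℝ} {s : Finset V} {x : E}
    (hb : IsBary r a s x) {p : V} (hp : p ∈ s) (hpt : ∀ v ∈ s, r (v : E) p) :
    r x p ∧ r (p : E) x := by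
  have hle : ∀ {b : V → ℝ} {t : Finset V} {y : E}, IsBary r b t y → t ⊆ s → r y p := by
    intro b t y hb' hts
    rw [← hb'.sum_smul]
    exact (h.convex p).sum_mem (fun v hv => (hb'.pos v hv).le) hb'.sum
      fun v hv => hpt v (hts hv)
  refine ⟨hle hb subset_rfl, ?_⟩
  classical
  rcases hb.cases hp with ⟨-, -, rfl⟩ | ⟨hlt, y, hy, rfl⟩
  · exact h.refl (h.subset p.2)
  · exact h.segment (hle hy (Finset.erase_subset _ _)) (hb.pos p hp) hlt.le

-- The face opposite the top vertex `p` lies in the cell frontier: the cell of `y` is that of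
-- another representative `q ≠ p` below `p`.
open Classical in
theorem IsBary.not_rel_erase (h : IsCellRelation W V r) {b : V → ℝ} {s : Finset V} {y : E}
    {p : V} (hpt : ∀ v ∈ s, r (v : E) p)
    (hb : IsBary r b (s.erase p) y) : r y p ∧ ¬ r (p : E) y := by
  obtain ⟨q, hq, hqt⟩ := h.exists_top hb.mem
  obtain ⟨h1, h2⟩ := hb.equiv_top h hq hqt
  have hqp : r (q : E) p := hpt q (Finset.mem_of_mem_erase hq)
  refine ⟨h.trans h1 hqp, fun hpy => ?_⟩
  exact Finset.ne_of_mem_erase hq (Subtype.ext (h.antisymm q.2 p.2 hqp (h.trans hpy h1)))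

/-- The top vertex must represent the cell of `x`, so both chains share it. Then `ray_unique`
identifies its weight and the opposite frontier point, and induction on the chain applies. -/
theorem IsBary.unique (h : IsCellRelation W V r) {a b : V → ℝ} {s t : Finset V} {x : E}
    (ha : IsBary r a s x) (hb : IsBary r b t x) : a = b := by
  classical
  induction hn : s.card using Nat.strong_induction_on generalizing a b s t x with
  | _ n ih =>
    obtain ⟨p, hp, hpt⟩ := h.exists_top ha.mem
    obtain ⟨q, hq, hqt⟩ := h.exists_top hb.mem
    have h1 := ha.equiv_top h hp hpt
    have h2 := hb.equiv_top h hq hqt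
    obtain rfl : p = q :=
      Subtype.ext (h.antisymm p.2 q.2 (h.trans h1.2 h2.1) (h.trans h2.2 h1.1))
    have hcontra : ∀ {c : ℝ} {y : E}, c < 1 → ¬ r (p : E) y →
        (p : E) ≠ c • (p : E) + (1 - c) • y := by
      intro c y hc hy he
      apply hy
      have h3 : (1 - c) • (p : E) = (1 - c) • y := by
        rw [sub_smul, one_smul, sub_eq_iff_eq_add', ← he]
      rw [← smul_right_injective E (by linarith : (1 - c) ≠ 0) h3]
      exact h.refl (h.subset p.2)
    rcases ha.cases hp with ⟨hs, ha1, hxp⟩ | ⟨halt, y, hy, hxy⟩ <;>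
      rcases hb.cases hq with ⟨ht, hb1, hxp'⟩ | ⟨hblt, z, hz, hxz⟩
    · ext v
      by_cases hv : v = p
      · rw [hv, ha1, hb1]
      · rw [ha.zero v (by simpa [hs] using hv), hb.zero v (by simpa [ht] using hv)]
    · exact (hcontra hblt (hz.not_rel_erase h hqt).2 (hxp.symm.trans hxz)).elim
    · exact (hcontra halt (hy.not_rel_erase h hpt).2 (hxp'.symm.trans hxy)).elim
    · have hy' := hy.not_rel_erase h hpt
      have hz' := hz.not_rel_erase h hqt
      obtain ⟨hab, rfl⟩ := h.ray_unique hy'.1 hy'.2 hz'.1 hz'.2 halt hblt (hxy.symm.trans hxz)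
      have := ih _ (by rw [← hn]; exact Finset.card_erase_lt_of_mem hp) hy hz rfl
      ext v
      by_cases hv : v = p
      · rw [hv, hab]
      · have h3 := congrFun this v
        simp only [if_neg hv, hab] at h3
        have h4 : (1 - b p)⁻¹ ≠ 0 := inv_ne_zero (by linarith)
        exact mul_left_cancel₀ h4 h3

/-- Project `x` from its representative `p` to the frontier of the cell. Fewer representatives lie
below the projection, since `p` no longer does, so induction applies. -/
theorem exists_isBary (h : IsCellRelation W V r) {x : E} (hx : x ∈ W) :
    ∃ (a : V → ℝ) (s : Finset V), IsBary r a s x := by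
  classical
  induction hn : {v | v ∈ V ∧ r v x}.ncard using Nat.strong_induction_on generalizing x with
  | _ n ih =>
    obtain ⟨p, hpV, hxp, hpx⟩ := h.exists_rep hx
    by_cases hne : x = p
    · refine ⟨Pi.single ⟨p, hpV⟩ 1, {⟨p, hpV⟩}, ⟨by simp, ?_⟩, ?_, ?_, ?_, ?_⟩
      · simpa using h.refl (h.mem_left hpx)
      · simp
      · intro v hv
        exact Pi.single_eq_of_ne (by simpa using hv) _
      · simp
      · simp [hne]
    · obtain ⟨t, y, ht0, ht1, hyp, hpy, hxe⟩ := h.exists_ray hxp hpx hne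
      have hlt : {v | v ∈ V ∧ r v y}.ncard < n := by
        rw [← hn]
        refine Set.ncard_lt_ncard ⟨?_, fun hsub => ?_⟩ (h.finite_below hx)
        · exact fun v hv => ⟨hv.1, h.trans hv.2 (h.trans hyp hpx)⟩
        · exact hpy (hsub ⟨hpV, hpx⟩).2
      obtain ⟨b, s, hb⟩ := ih _ hlt (h.mem_left hyp) rfl
      obtain ⟨q, hq, hqt⟩ := h.exists_top hb.mem
      have hqy := hb.equiv_top h hq hqt
      have hsy : ∀ v ∈ s, r (v : E) y := fun v hv => h.trans (hqt v hv) hqy.2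
      have hps : (⟨p, hpV⟩ : V) ∉ s := fun hps => hpy (hsy _ hps)
      have hne' : ∀ v ∈ s, v ≠ (⟨p, hpV⟩ : V) := fun v hv hvp => hps (hvp ▸ hv)
      refine ⟨fun v => if v = ⟨p, hpV⟩ then t else (1 - t) * b v, insert ⟨p, hpV⟩ s,
        ⟨by simp, ?_⟩, ?_, ?_, ?_, ?_⟩
      · intro v hv w hw
        have hvp : r (p : E) p := h.refl (h.mem_left hpx)
        rcases Finset.mem_insert.1 hv with rfl | hv <;> rcases Finset.mem_insert.1 hw with rfl | hw
        · exact Or.inl hvp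
        · exact Or.inr (h.trans (hsy w hw) hyp)
        · exact Or.inl (h.trans (hsy v hv) hyp)
        · exact hb.mem.2 v hv w hw
      · intro v hv
        by_cases hvp : v = ⟨p, hpV⟩
        · rwa [if_pos hvp]
        · rw [if_neg hvp]
          exact mul_pos (by linarith) (hb.pos v (Finset.mem_of_mem_insert_of_ne hv hvp))
      · intro v hv
        rw [Finset.mem_insert, not_or] at hv
        rw [if_neg hv.1, hb.zero v hv.2, mul_zero]
      · rw [Finset.sum_insert hps, if_pos rfl,
          Finset.sum_congr rfl fun v hv => if_neg (hne' v hv), ← Finset.mul_sum, hb.sum]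
        ring
      · rw [Finset.sum_insert hps, if_pos rfl, hxe, ← hb.sum_smul, Finset.smul_sum]
        congr 1
        refine Finset.sum_congr rfl fun v hv => ?_
        rw [if_neg (hne' v hv), mul_smul]

end IsCellRelation

/-! ### Finite simplices in `ℓ²` -/

theorem coe_sum_single {V : Type*} [DecidableEq V] {a : V → ℝ} {s : Finset V} (hz : ∀ v ∉ s, a v = 0) (w : V) :
    (∑ v ∈ s, lp.single (E := fun _ : V => ℝ) 2 v (a v)) w = a w := by
  rw [lp.coeFn_sum, Finset.sum_apply]
  simp only [lp.single_apply]
  by_cases hw : w ∈ s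
  · rw [Finset.sum_eq_single_of_mem w hw]
    · simp
    · intro v _ hvw
      simp [hvw.symm]
  · rw [hz w hw]
    refine Finset.sum_eq_zero fun v hv => ?_
    have : w ≠ v := fun h => hw (h ▸ hv)
    simp [this]

theorem lp.continuous_coord {V : Type*} (v : V) :
    Continuous fun x : lp (fun _ : V => ℝ) 2 => x v :=
  (continuous_apply v).comp lp.uniformContinuous_coe.continuous

/-- The closed simplex spanned by a finite set of vertices is compact. -/
theorem isCompact_simplex {V : Type*} (s : Finset V) :
    IsCompact {x : lp (fun _ : V => ℝ) 2 | (∀ v, 0 ≤ x v) ∧ (∀ v, v ∉ s → x v = 0) ∧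
      ∑ v ∈ s, x v = 1} := by
  classical
  let A : Set (V → ℝ) := {a | (∀ v, 0 ≤ a v) ∧ (∀ v, v ∉ s → a v = 0) ∧ ∑ v ∈ s, a v = 1}
  have hA : IsCompact A := by
    refine (isCompact_univ_pi fun _ : V => isCompact_Icc (a := (0 : ℝ)) (b := 1)).of_isClosed_subset
      ?_ ?_
    · refine IsClosed.inter ?_ (IsClosed.inter ?_ ?_)
      · change IsClosed {a : V → ℝ | ∀ v, 0 ≤ a v}
        simp only [Set.ofPred_forall]
        exact isClosed_iInter fun v => isClosed_le continuous_const (continuous_apply v)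
      · change IsClosed {a : V → ℝ | ∀ v, v ∉ s → a v = 0}
        simp only [Set.ofPred_forall]
        exact isClosed_iInter fun v => isClosed_iInter fun _ =>
          isClosed_eq (continuous_apply v) continuous_const
      · exact isClosed_eq (continuous_finsetSum _ fun v _ => continuous_apply v) continuous_const
    · rintro a ⟨h0, hz, h1⟩ v -
      refine ⟨h0 v, ?_⟩
      by_cases hv : v ∈ s
      · rw [← h1]
        exact Finset.single_le_sum (fun w _ => h0 w) hv
      · rw [hz v hv]
        exact zero_le_one
  -- Only finitely many coordinates occur, so the product topology already controls the `ℓ²` norm.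
  have hG : Continuous fun a : V → ℝ => ∑ v ∈ s, lp.single (E := fun _ : V => ℝ) 2 v (a v) :=
    continuous_finsetSum _ fun v _ => (lp.isometry_single v).continuous.comp (continuous_apply v)
  convert hA.image hG using 1
  ext x
  constructor
  · rintro ⟨h0, hz, h1⟩
    refine ⟨fun v => x v, ⟨h0, hz, h1⟩, ?_⟩
    apply lp.ext
    ext w
    exact coe_sum_single hz w
  · rintro ⟨a, ⟨h0, hz, h1⟩, rfl⟩
    refine ⟨fun v => ?_, fun v hv => ?_, ?_⟩
    · rw [coe_sum_single hz]
      exact h0 v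
    · rw [coe_sum_single hz]
      exact hz v hv
    · simp only [coe_sum_single hz, h1]

/-! ### Triangulation by the order complex -/

namespace IsCellRelation

variable {E : Type u} [NormedAddCommGroup E] [NormedSpace ℝ E] {W V : Set E} {r : E → E → Prop}

/-- The point with given barycentric coordinates. -/
noncomputable def baryMap (V : Set E) (r : E → E → Prop)
    (x : simplicialRealization (orderComplex V r)) : E :=
  ∑ᶠ v : V, (x : lp (fun _ : V => ℝ) 2) v • (v : E)

-- The simplex carrying `x` may have vertices of weight zero; discarding them gives the positivity
-- that `IsBary` demands.
open Classical in
theorem exists_isBary_baryMap (x : simplicialRealization (orderComplex V r)) :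
    ∃ s, IsBary r (fun v => (x : lp (fun _ : V => ℝ) 2) v) s (baryMap V r x) := by
  obtain ⟨x, hx0, s, hs, hxs, hsum⟩ := x
  have hpos : ∀ v ∈ s, v ∉ s.filter (fun v => 0 < x v) → x v = 0 := by
    intro v hv hv'
    rw [Finset.mem_filter, not_and] at hv'
    exact le_antisymm (not_lt.1 (hv' hv)) (hx0 v)
  have hsum' : ∑ v ∈ s.filter (fun v => 0 < x v), x v = 1 := by
    rw [← hsum]
    exact Finset.sum_subset (Finset.filter_subset _ _) hpos
  have hzero : ∀ v ∉ s.filter (fun v => 0 < x v), x v = 0 := by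
    intro v hv
    by_cases hvs : v ∈ s
    · exact hpos v hvs hv
    · exact hxs v hvs
  refine ⟨s.filter (fun v => 0 < x v), ⟨?_, ?_⟩, ?_, hzero, hsum', ?_⟩
  · rw [Finset.nonempty_iff_ne_empty]
    intro he
    simp [he] at hsum'
  · intro p hp q hq
    exact hs.2 p (Finset.mem_filter.1 hp).1 q (Finset.mem_filter.1 hq).1
  · intro v hv
    exact (Finset.mem_filter.1 hv).2
  · refine (finsum_eq_sum_of_support_subset _ fun v hv => ?_).symm
    by_contra hvs
    exact hv (by simp only [hzero v hvs, zero_smul])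

theorem baryMap_injective (h : IsCellRelation W V r) : Function.Injective (baryMap V r) := by
  intro x y hxy
  obtain ⟨s, hs⟩ := exists_isBary_baryMap x
  obtain ⟨t, ht⟩ := exists_isBary_baryMap y
  rw [hxy] at hs
  have := hs.unique h ht
  apply Subtype.ext
  apply lp.ext
  exact this

theorem range_baryMap (h : IsCellRelation W V r) : Set.range (baryMap V r) = W := by
  classical
  ext x
  constructor
  · rintro ⟨x, rfl⟩
    obtain ⟨s, hs⟩ := exists_isBary_baryMap x
    obtain ⟨p, hp, hpt⟩ := h.exists_top hs.mem
    exact h.mem_left (hs.equiv_top h hp hpt).1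
  · intro hx
    obtain ⟨a, s, ha⟩ := h.exists_isBary hx
    have hc := coe_sum_single ha.zero
    refine ⟨⟨∑ v ∈ s, lp.single (E := fun _ : V => ℝ) 2 v (a v), ?_, s, ha.mem, ?_, ?_⟩, ?_⟩
    · intro v
      rw [hc]
      by_cases hv : v ∈ s
      · exact (ha.pos v hv).le
      · exact (ha.zero v hv).ge
    · intro v hv
      rw [hc, ha.zero v hv]
    · simp only [hc, ha.sum]
    · refine Eq.trans ?_ ha.sum_smul
      simp only [baryMap, hc]
      refine finsum_eq_sum_of_support_subset _ fun v hv => ?_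
      by_contra hvs
      exact hv (by simp only [ha.zero v hvs, zero_smul])

/-- Fix a vertex `v` with `x v > 0`. Nearby points also have `v` in their chain, so only the
finitely many cells comparable to `v` contribute to the sum. -/
theorem continuous_baryMap (h : IsCellRelation W V r) : Continuous (baryMap V r) := by
  classical
  rw [continuous_iff_continuousAt]
  intro x
  obtain ⟨s, hs⟩ := exists_isBary_baryMap x
  obtain ⟨v, hv⟩ := hs.mem.1
  have hf : {w : V | r (w : E) v ∨ r (v : E) w}.Finite := by
    have h1 := (h.finite_below (h.subset v.2)).union (h.finite_above (h.subset v.2))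
    refine (h1.preimage (f := ((↑) : V → E)) Subtype.val_injective.injOn).subset ?_
    rintro w (hw | hw)
    · exact Or.inl ⟨w.2, hw⟩
    · exact Or.inr ⟨w.2, hw⟩
  have hc : ∀ w : V, Continuous fun y : simplicialRealization (orderComplex V r) =>
      (y : lp (fun _ : V => ℝ) 2) w := fun w => (lp.continuous_coord w).comp continuous_subtype_val
  have hnear : ∀ᶠ y : simplicialRealization (orderComplex V r) in 𝓝 x,
      0 < (y : lp (fun _ : V => ℝ) 2) v :=
    (hc v).continuousAt.eventually (lt_mem_nhds (hs.pos v hv))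
  have heq : (fun y : simplicialRealization (orderComplex V r) =>
      ∑ w ∈ hf.toFinset, (y : lp (fun _ : V => ℝ) 2) w • (w : E)) =ᶠ[𝓝 x] baryMap V r := by
    filter_upwards [hnear] with y hy
    obtain ⟨t, ht⟩ := exists_isBary_baryMap y
    rw [← ht.sum_smul]
    symm
    refine Finset.sum_subset (fun w hw => ?_) fun w _ hw => ?_
    · rw [Set.Finite.mem_toFinset]
      refine ht.mem.2 w hw v ?_
      by_contra hvt
      exact hy.ne' (ht.zero v hvt)
    · rw [ht.zero w hw, zero_smul]
  refine ContinuousAt.congr ?_ heq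
  refine Continuous.continuousAt ?_
  exact continuous_finsetSum _ fun w _ => (hc w).smul continuous_const

/-- A neighborhood meeting finitely many cells has its preimage in finitely many simplices, whose
union is compact. Properness yields closedness and thus a continuous inverse. -/
theorem isProperMap_baryMap (h : IsCellRelation W V r) :
    IsProperMap (fun x => (⟨baryMap V r x, h.range_baryMap ▸ ⟨x, rfl⟩⟩ : W)) := by
  classical
  have hcont : Continuous (fun x => (⟨baryMap V r x, h.range_baryMap ▸ ⟨x, rfl⟩⟩ : W)) :=
    h.continuous_baryMap.subtype_mk _
  refine isProperMap_iff_ultrafilter_of_t2.2 ⟨hcont, fun 𝒰 y hy => ?_⟩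
  obtain ⟨N, hN, hNf⟩ := h.finite y y.2
  have hN' : ((↑) : W → E) ⁻¹' N ∈ 𝓝 y := by
    rw [nhds_subtype_eq_comap_nhdsWithin]
    exact Filter.preimage_mem_comap hN
  let G : Set E := ⋃ p ∈ {v | v ∈ V ∧ ∃ y ∈ N, r v y ∧ r y v}, {v | v ∈ V ∧ r v p}
  have hG : G.Finite := hNf.biUnion fun p hp => h.finite_below (h.subset hp.1)
  have hGV : (((↑) : V → E) ⁻¹' G).Finite := hG.preimage Subtype.val_injective.injOn
  let C : Set (simplicialRealization (orderComplex V r)) :=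
    ⋃ s ∈ (hGV.toFinset.powerset : Set (Finset V)) ∩ (orderComplex V r).faces,
      (↑) ⁻¹' {x : lp (fun _ : V => ℝ) 2 | (∀ v, 0 ≤ x v) ∧ (∀ v, v ∉ s → x v = 0) ∧
        ∑ v ∈ s, x v = 1}
  have hC : IsCompact C := by
    refine ((Finset.finite_toSet _).inter_of_left _).isCompact_biUnion fun s hs => ?_
    refine IsInducing.subtypeVal.isCompact_preimage' (isCompact_simplex s) ?_
    rintro x ⟨h0, hz, h1⟩
    exact Subtype.range_val ▸ ⟨h0, s, hs.2, hz, h1⟩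
  have hCU : C ∈ 𝒰 := by
    filter_upwards [hy hN'] with x hx
    obtain ⟨s, hs⟩ := exists_isBary_baryMap x
    obtain ⟨p, hp, hpt⟩ := h.exists_top hs.mem
    have hxp := hs.equiv_top h hp hpt
    refine Set.mem_biUnion (x := s) ⟨?_, hs.mem⟩ ⟨x.2.1, hs.zero, hs.sum⟩
    rw [Finset.mem_coe, Finset.mem_powerset]
    intro v hv
    rw [Set.Finite.mem_toFinset]
    exact Set.mem_biUnion (x := (p : E)) ⟨p.2, _, hx, hxp.2, hxp.1⟩ ⟨v.2, hpt v hv⟩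
  obtain ⟨x, -, hx⟩ := hC.ultrafilter_le_nhds 𝒰 (Filter.le_principal_iff.2 hCU)
  exact ⟨x, hx⟩

/-- A space with a locally finite convex cell decomposition is triangulated by the order complex
of the cells. -/
theorem isPolyhedron (h : IsCellRelation W V r) : IsPolyhedron W := by
  have hp := h.isProperMap_baryMap
  let e : simplicialRealization (orderComplex V r) ≃ W := Equiv.ofBijective
    (fun x => (⟨baryMap V r x, h.range_baryMap ▸ ⟨x, rfl⟩⟩ : W)) ⟨fun x y hxy =>
      h.baryMap_injective (congrArg Subtype.val hxy), fun y => by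
        obtain ⟨x, hx⟩ : (y : E) ∈ Set.range (baryMap V r) := h.range_baryMap ▸ y.2
        exact ⟨x, Subtype.ext hx⟩⟩
  exact ⟨V, orderComplex V r, ⟨(e.toHomeomorphOfContinuousClosed hp.continuous hp.isClosedMap).symm⟩⟩

end IsCellRelation

/-! ### Dyadic cells of a fixed level -/

/-- `x` lies in the closed dyadic cell of level `k` that contains `y` in its relative interior. -/
def DyadicRel {ι : Type*} (k : ℕ) (x y : ι → ℝ) : Prop :=
  ∀ i, (⌊2 ^ k * y i⌋ : ℝ) ≤ 2 ^ k * x i ∧ 2 ^ k * x i ≤ ⌈2 ^ k * y i⌉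

namespace DyadicRel

variable {ι : Type*} {k l : ℕ} {x y z : ι → ℝ}

theorem refl (k : ℕ) (x : ι → ℝ) : DyadicRel k x x :=
  fun _ => ⟨Int.floor_le _, Int.le_ceil _⟩

theorem floor_le_floor (h : DyadicRel k x y) (i : ι) : ⌊2 ^ k * y i⌋ ≤ ⌊2 ^ k * x i⌋ :=
  Int.le_floor.2 (h i).1

theorem ceil_le_ceil (h : DyadicRel k x y) (i : ι) : ⌈2 ^ k * x i⌉ ≤ ⌈2 ^ k * y i⌉ :=
  Int.ceil_le.2 (h i).2

theorem trans (h : DyadicRel k x y) (h' : DyadicRel k y z) : DyadicRel k x z := fun i =>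
  ⟨le_trans (by exact_mod_cast h'.floor_le_floor i) (h i).1,
    (h i).2.trans (by exact_mod_cast h'.ceil_le_ceil i)⟩

theorem of_eq (hf : ∀ i, ⌊2 ^ k * x i⌋ = ⌊2 ^ k * y i⌋) (hc : ∀ i, ⌈2 ^ k * x i⌉ = ⌈2 ^ k * y i⌉) :
    DyadicRel k x y := fun i => ⟨hf i ▸ Int.floor_le _, hc i ▸ Int.le_ceil _⟩

/-- Dyadic grids refine one another: `2⌊a⌋ ≤ ⌊2a⌋` and `⌈2a⌉ ≤ 2⌈a⌉`. -/
theorem of_succ (h : DyadicRel (k + 1) x y) : DyadicRel k x y := by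
  intro i
  obtain ⟨h1, h2⟩ := h i
  have e1 : ∀ w : ι → ℝ, (2 : ℝ) ^ (k + 1) * w i = 2 * (2 ^ k * w i) := fun w => by ring
  rw [e1] at h1 h2
  rw [e1] at h1 h2
  constructor
  · have : (2 * ⌊2 ^ k * y i⌋ : ℤ) ≤ ⌊2 * (2 ^ k * y i)⌋ := by
      rw [Int.le_floor]
      push_cast
      linarith [Int.floor_le (2 ^ k * y i)]
    have h3 : (2 * ⌊2 ^ k * y i⌋ : ℝ) ≤ ⌊2 * (2 ^ k * y i)⌋ := by exact_mod_cast this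
    linarith
  · have : ⌈2 * (2 ^ k * y i)⌉ ≤ (2 * ⌈2 ^ k * y i⌉ : ℤ) := by
      rw [Int.ceil_le]
      push_cast
      linarith [Int.le_ceil (2 ^ k * y i)]
    have h3 : (⌈2 * (2 ^ k * y i)⌉ : ℝ) ≤ 2 * ⌈2 ^ k * y i⌉ := by exact_mod_cast this
    linarith

theorem of_le (hkl : k ≤ l) (h : DyadicRel l x y) : DyadicRel k x y := by
  induction l, hkl using Nat.le_induction with
  | base => exact h
  | succ l _ ih => exact ih h.of_succ

theorem abs_sub_le (h : DyadicRel k x z) (h' : DyadicRel k y z) (i : ι) :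
    |x i - y i| ≤ (2 ^ k)⁻¹ := by
  have h2 : (0 : ℝ) < 2 ^ k := by positivity
  have h3 : (⌈2 ^ k * z i⌉ : ℝ) ≤ ⌊2 ^ k * z i⌋ + 1 := by
    exact_mod_cast Int.ceil_le_floor_add_one (2 ^ k * z i)
  have h4 : (2 : ℝ) ^ k * |x i - y i| ≤ 1 := by
    have h5 : |2 ^ k * (x i - y i)| = 2 ^ k * |x i - y i| := by rw [abs_mul, abs_of_pos h2]
    rw [← h5, mul_sub, abs_le]
    constructor <;> linarith [(h i).1, (h i).2, (h' i).1, (h' i).2]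
  rwa [← one_div, le_div_iff₀' h2]

theorem setOf_eq_Icc (k : ℕ) (y : ι → ℝ) : {x | DyadicRel k x y} =
    Set.Icc (fun i => (⌊2 ^ k * y i⌋ : ℝ) / 2 ^ k) (fun i => (⌈2 ^ k * y i⌉ : ℝ) / 2 ^ k) := by
  have h2 : (0 : ℝ) < 2 ^ k := by positivity
  ext x
  simp only [Set.mem_ofPred_eq, DyadicRel, Set.mem_Icc, Pi.le_def, ← forall_and, div_le_iff₀' h2,
    le_div_iff₀' h2]

/-- In each coordinate, a positive weight on `y` keeps the combination strictly below `⌈a⌉` whenever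
`a` is, so its floor does not exceed `⌊a⌋`; dually for ceilings. -/
theorem segment {t : ℝ} (h : DyadicRel k x y) (h0 : 0 < t) (h1 : t ≤ 1) :
    DyadicRel k y (t • y + (1 - t) • x) := by
  intro i
  obtain ⟨hl, hr⟩ := h i
  have e : 2 ^ k * (t • y + (1 - t) • x) i = t * (2 ^ k * y i) + (1 - t) * (2 ^ k * x i) := by
    simp only [Pi.add_apply, Pi.smul_apply, smul_eq_mul]
    ring
  rw [e]
  generalize 2 ^ k * y i = a at *
  generalize 2 ^ k * x i = b at *
  have hfc : (⌈a⌉ : ℝ) ≤ ⌊a⌋ + 1 := by exact_mod_cast Int.ceil_le_floor_add_one a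
  have hfa := Int.floor_le a
  have hca := Int.le_ceil a
  constructor
  · rcases hca.eq_or_lt with ha | ha
    · refine (Int.floor_le _).trans ?_
      nlinarith
    · have : ⌊t * a + (1 - t) * b⌋ < ⌈a⌉ := by
        rw [Int.floor_lt]
        nlinarith
      have h3 : ⌊t * a + (1 - t) * b⌋ ≤ ⌊a⌋ := by
        have := Int.ceil_le_floor_add_one a
        omega
      exact le_trans (by exact_mod_cast h3) hfa
  · rcases hfa.eq_or_lt with ha | ha
    · refine le_trans ?_ (Int.le_ceil _)
      nlinarith
    · have : ⌊a⌋ < ⌈t * a + (1 - t) * b⌉ := by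
        rw [Int.lt_ceil]
        nlinarith
      have h3 : ⌈a⌉ ≤ ⌈t * a + (1 - t) * b⌉ := by
        have := Int.ceil_le_floor_add_one a
        omega
      exact hca.trans (by exact_mod_cast h3)

/-- Equal coordinates do not move; unequal ones in the same cell lie strictly inside an interval and
have room on both sides. -/
theorem eventually_extend [Finite ι] (h : DyadicRel k x y) (h' : DyadicRel k y x) :
    ∀ᶠ ε : ℝ in 𝓝[>] 0, DyadicRel k (x + ε • (x - y)) y := by
  refine Filter.eventually_all.2 fun i => ?_
  obtain ⟨hl, hr⟩ := h i
  obtain ⟨hl', hr'⟩ := h' i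
  have e : ∀ ε : ℝ, 2 ^ k * (x + ε • (x - y)) i =
      2 ^ k * x i + ε * (2 ^ k * x i - 2 ^ k * y i) := fun ε => by
    simp only [Pi.add_apply, Pi.smul_apply, Pi.sub_apply, smul_eq_mul]
    ring
  simp only [e]
  generalize 2 ^ k * x i = a at *
  generalize 2 ^ k * y i = b at *
  by_cases hab : a = b
  · refine Filter.Eventually.of_forall fun ε => ?_
    rw [hab, sub_self, mul_zero, add_zero]
    exact ⟨Int.floor_le b, Int.le_ceil b⟩
  · have hl2 : (⌊b⌋ : ℝ) < a := by
      refine lt_of_le_of_ne hl fun he => hab ?_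
      rw [← he, Int.ceil_intCast] at hr'
      exact he.symm.trans (le_antisymm (Int.floor_le b) hr')
    have hr2 : a < ⌈b⌉ := by
      refine lt_of_le_of_ne hr fun he => hab ?_
      rw [he, Int.floor_intCast] at hl'
      exact he.trans (le_antisymm hl' (Int.le_ceil b))
    have hc : Filter.Tendsto (fun ε : ℝ => a + ε * (a - b)) (𝓝[>] 0) (𝓝 a) := by
      have : Continuous fun ε : ℝ => a + ε * (a - b) := by fun_prop
      simpa using (this.tendsto 0).mono_left nhdsWithin_le_nhds
    filter_upwards [hc.eventually (lt_mem_nhds hl2), hc.eventually (gt_mem_nhds hr2)] with ε h1 h2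
    exact ⟨h1.le, h2.le⟩

end DyadicRel

/-! ### Dyadic cells of varying level in an open subset -/

section Triangulation

variable {ι : Type u} [Fintype ι]

/-- Every point of `P` sharing a closed dyadic cell of level `k` with `x` lies in `W`. -/
def DyadicFine (P W : Set (ι → ℝ)) (k : ℕ) (x : ι → ℝ) : Prop :=
  ∀ z ∈ P, DyadicRel k x z → ∀ y ∈ P, DyadicRel k y z → y ∈ W

/-- The level of the dyadic cell chosen around `x`. -/
noncomputable def dyadicLevel (P W : Set (ι → ℝ)) (x : ι → ℝ) : ℕ :=
  sInf {k | DyadicFine P W k x}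

variable {P W : Set (ι → ℝ)}

/-- Cells of level `k` have side at most `2⁻ᵏ`. That one level serves a whole neighborhood is the
source of local finiteness. -/
theorem exists_forall_dyadicFine
    (hW : ∀ x ∈ W, ∃ ε > 0, ∀ y ∈ P, dist y x < ε → y ∈ W) {x : ι → ℝ} (hx : x ∈ W) :
    ∃ k, ∀ᶠ y in 𝓝 x, DyadicFine P W k y := by
  obtain ⟨ε, hε, hP⟩ := hW x hx
  obtain ⟨k, hk⟩ := exists_pow_lt_of_lt_one (half_pos hε) (by norm_num : (2 : ℝ)⁻¹ < 1)
  refine ⟨k, ?_⟩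
  filter_upwards [Metric.ball_mem_nhds x (half_pos hε)] with y hy z _ hyz w hw hwz
  apply hP w hw
  have h1 : dist w y ≤ (2 ^ k)⁻¹ :=
    (dist_pi_le_iff (by positivity)).2 fun i => hwz.abs_sub_le hyz i
  rw [inv_pow] at hk
  have h2 := dist_triangle w y x
  have h3 : dist y x < ε / 2 := hy
  linarith

/-- On `W` the infimum is over a nonempty set, hence attained rather than the default `0`. -/
theorem dyadicFine_level (hW : ∀ x ∈ W, ∃ ε > 0, ∀ y ∈ P, dist y x < ε → y ∈ W)
    {x : ι → ℝ} (hx : x ∈ W) : DyadicFine P W (dyadicLevel P W x) x := by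
  obtain ⟨k, hk⟩ := exists_forall_dyadicFine hW hx
  exact Nat.sInf_mem (s := {k | DyadicFine P W k x}) ⟨k, hk.self_of_nhds⟩

/-- The grid respects faces: a cell at `y` stays nonnegative, and `y i = 0` forces the coordinate
`i` to vanish on it. -/
theorem DyadicRel.mem_of_sum_eq_one (hP : ∀ x ∈ P, (∀ i, 0 ≤ x i) ∧ ∑ i, x i = 1)
    (hPd : ∀ x ∈ P, ∀ y : ι → ℝ, (∀ i, 0 ≤ y i) → ∑ i, y i = 1 → (∀ i, x i = 0 → y i = 0) → y ∈ P)
    {k : ℕ} {x y : ι → ℝ} (hy : y ∈ P) (h : DyadicRel k x y) (hx : ∑ i, x i = 1) : x ∈ P := by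
  have h2 : (0 : ℝ) < 2 ^ k := by positivity
  have h0 : ∀ i, 0 ≤ x i := fun i => by
    have h1 : (0 : ℝ) ≤ ⌊2 ^ k * y i⌋ := by
      exact_mod_cast Int.floor_nonneg.2 (mul_nonneg h2.le ((hP y hy).1 i))
    exact nonneg_of_mul_nonneg_right (h1.trans (h i).1) h2
  refine hPd y hy x h0 hx fun i hi => le_antisymm ?_ (h0 i)
  have := (h i).2
  rw [hi, mul_zero, Int.ceil_zero, Int.cast_zero] at this
  exact nonpos_of_mul_nonpos_right this h2

/-- A closed cell containing `y` at a coarser level also contains `x`. So a smaller level fine at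
`x` would be fine at `y`, against minimality. -/
theorem dyadicLevel_le
    (hW : ∀ x ∈ W, ∃ ε > 0, ∀ y ∈ P, dist y x < ε → y ∈ W)
    {x y : ι → ℝ} (hx : x ∈ W) (h : DyadicRel (dyadicLevel P W y) x y) :
    dyadicLevel P W y ≤ dyadicLevel P W x := by
  by_contra! hlt
  refine Nat.notMem_of_lt_sInf hlt fun z hz hyz => ?_
  exact dyadicFine_level hW hx z hz ((h.of_le hlt.le).trans hyz)

theorem dyadicLevel_eq
    (hW : ∀ x ∈ W, ∃ ε > 0, ∀ y ∈ P, dist y x < ε → y ∈ W)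
    {x y : ι → ℝ} (hx : x ∈ W) (hy : y ∈ W) (h : DyadicRel (dyadicLevel P W y) x y)
    (h' : DyadicRel (dyadicLevel P W y) y x) : dyadicLevel P W x = dyadicLevel P W y := by
  refine le_antisymm (Nat.sInf_le fun z hz hxz => ?_) (dyadicLevel_le hW hx h)
  exact dyadicFine_level hW hy z hz (h'.trans hxz)

theorem exists_representatives {E : Type*} {W : Set E} {r : E → E → Prop}
    (hrefl : ∀ x ∈ W, r x x) (htrans : ∀ x y z, r x y → r y z → r x z) :
    ∃ V ⊆ W, (∀ x ∈ W, ∃ p ∈ V, r x p ∧ r p x) ∧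
      ∀ p ∈ V, ∀ q ∈ V, r p q → r q p → p = q := by
  let S : Setoid W := ⟨fun x y => r x y ∧ r y x, fun x => ⟨hrefl x x.2, hrefl x x.2⟩,
    fun h => ⟨h.2, h.1⟩, fun h h' => ⟨htrans _ _ _ h.1 h'.1, htrans _ _ _ h'.2 h.2⟩⟩
  refine ⟨Set.range fun q : Quotient S => (q.out : E), ?_, ?_, ?_⟩
  · rintro _ ⟨q, rfl⟩
    exact q.out.2
  · intro x hx
    refine ⟨_, ⟨Quotient.mk S ⟨x, hx⟩, rfl⟩, ?_⟩
    have := Quotient.mk_out (s := S) ⟨x, hx⟩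
    exact ⟨this.2, this.1⟩
  · rintro _ ⟨p, rfl⟩ _ ⟨q, rfl⟩ h1 h2
    have : p.out ≈ q.out := ⟨h1, h2⟩
    simp only [Quotient.out_equiv_out.1 this]

/-- A relatively open subset of a subcomplex `P` of the standard simplex is a polyhedron. -/
theorem isPolyhedron_of_relatively_open (hP : ∀ x ∈ P, (∀ i, 0 ≤ x i) ∧ ∑ i, x i = 1)
    (hPd : ∀ x ∈ P, ∀ y : ι → ℝ, (∀ i, 0 ≤ y i) → ∑ i, y i = 1 → (∀ i, x i = 0 → y i = 0) → y ∈ P)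
    (hWP : W ⊆ P) (hW : ∀ x ∈ W, ∃ ε > 0, ∀ y ∈ P, dist y x < ε → y ∈ W) : IsPolyhedron W := by
  classical
  let r : (ι → ℝ) → (ι → ℝ) → Prop := fun x y =>
    x ∈ W ∧ y ∈ W ∧ DyadicRel (dyadicLevel P W y) x y
  have hrefl : ∀ x ∈ W, r x x := fun x hx => ⟨hx, hx, DyadicRel.refl _ _⟩
  have htrans : ∀ x y z, r x y → r y z → r x z := fun x y z h h' =>
    ⟨h.1, h'.2.1, (h.2.2.of_le (dyadicLevel_le hW h'.1 h'.2.2)).trans h'.2.2⟩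
  have hset : ∀ y ∈ W, {x | r x y} =
      {x | DyadicRel (dyadicLevel P W y) x y} ∩ {x | ∑ i, x i = 1} := by
    intro y hy
    ext x
    refine ⟨fun h => ⟨h.2.2, (hP x (hWP h.1)).2⟩, fun h => ⟨?_, hy, h.1⟩⟩
    exact dyadicFine_level hW hy y (hWP hy) (DyadicRel.refl _ _) x
      (DyadicRel.mem_of_sum_eq_one hP hPd (hWP hy) h.1 h.2) h.1
  have hconv : ∀ y, Convex ℝ {x | r x y} := by
    intro y
    by_cases hy : y ∈ W
    · rw [hset y hy, DyadicRel.setOf_eq_Icc]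
      refine (convex_Icc _ _).inter ?_
      intro a ha b hb s t _ _ hst
      have ha' : ∑ i, a i = 1 := ha
      have hb' : ∑ i, b i = 1 := hb
      change ∑ i, (s * a i + t * b i) = 1
      rw [Finset.sum_add_distrib, ← Finset.mul_sum, ← Finset.mul_sum, ha', hb', mul_one, mul_one,
        hst]
    · convert convex_empty (𝕜 := ℝ) (E := ι → ℝ)
      exact Set.eq_empty_of_forall_notMem fun x hx => hy hx.2.1
  obtain ⟨V, hVW, hV, hVa⟩ := exists_representatives hrefl htrans
  have hcell : IsCellRelation W V r :=
    { mem_left := fun h => h.1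
      mem_right := fun h => h.2.1
      refl := fun h => hrefl _ h
      trans := fun h h' => htrans _ _ _ h h'
      convex := hconv
      isCompact := fun y hy => by
        rw [hset y hy, DyadicRel.setOf_eq_Icc]
        exact isCompact_Icc.inter_right (isClosed_eq (by fun_prop) continuous_const)
      segment := fun {x y t} h h0 h1 => by
        have hz : r (t • y + (1 - t) • x) y :=
          hconv y (hrefl y h.2.1) h h0.le (by linarith) (by ring)
        have hs := h.2.2.segment h0 h1
        refine ⟨h.2.1, hz.1, ?_⟩
        rw [dyadicLevel_eq hW hz.1 h.2.1 hz.2.2 hs]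
        exact hs
      extend := fun {x y} h h' _ => by
        have hl := le_antisymm (dyadicLevel_le hW h'.1 h'.2.2)
          (dyadicLevel_le hW h.1 h.2.2)
        have hyx := h'.2.2
        rw [hl] at hyx
        obtain ⟨ε, hr, hε⟩ := ((h.2.2.eventually_extend hyx).and self_mem_nhdsWithin).exists
        refine ⟨ε, hε, ?_⟩
        change _ ∈ {x | r x y}
        rw [hset y h.2.1]
        refine ⟨hr, ?_⟩
        change ∑ i, (x i + ε * (x i - y i)) = 1
        rw [Finset.sum_add_distrib, ← Finset.mul_sum, Finset.sum_sub_distrib,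
          (hP x (hWP h.1)).2, (hP y (hWP h.2.1)).2]
        ring
      subset := hVW
      exists_rep := fun h => hV _ h
      antisymm := fun hp hq h h' => hVa _ hp _ hq h h'
      finite := fun x hx => by
        obtain ⟨k, hk⟩ := exists_forall_dyadicFine hW hx
        refine ⟨{y | DyadicFine P W k y}, mem_nhdsWithin_of_mem_nhds hk, ?_⟩
        -- A cell is determined by its level and its integer corners. Near `x` levels are at most
        -- `k`, so the corners lie in `[0, 2 ^ k]`.
        let key : (ι → ℝ) → ℕ × (ι → ℤ) × (ι → ℤ) := fun v =>
          (dyadicLevel P W v, fun i => ⌊2 ^ dyadicLevel P W v * v i⌋,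
            fun i => ⌈2 ^ dyadicLevel P W v * v i⌉)
        have hfin : (Set.Iic k ×ˢ (Set.Icc (0 : ι → ℤ) (fun _ => 2 ^ k) ×ˢ
            Set.Icc (0 : ι → ℤ) (fun _ => 2 ^ k))).Finite :=
          (Set.finite_Iic k).prod ((Set.finite_Icc _ _).prod (Set.finite_Icc _ _))
        refine Set.Finite.of_finite_image (f := key) (hfin.subset ?_) ?_
        · rintro _ ⟨v, ⟨hv, y, hy, hvy, hyv⟩, rfl⟩
          have hl : dyadicLevel P W v ≤ k :=
            (dyadicLevel_le hW hyv.1 hyv.2.2).trans (Nat.sInf_le hy)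
          have h2 : (0 : ℝ) < 2 ^ dyadicLevel P W v := by positivity
          obtain ⟨hv0, hv1⟩ := hP v (hWP (hVW hv))
          have hv1' : ∀ i, v i ≤ 1 := fun i => by
            rw [← hv1]
            exact Finset.single_le_sum (fun j _ => hv0 j) (Finset.mem_univ i)
          have hle : ∀ i, (2 : ℝ) ^ dyadicLevel P W v * v i ≤ 2 ^ k := fun i =>
            (mul_le_of_le_one_right h2.le (hv1' i)).trans (pow_le_pow_right₀ one_le_two hl)
          have h0 : ∀ i, (0 : ℝ) ≤ 2 ^ dyadicLevel P W v * v i := fun i =>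
            mul_nonneg h2.le (hv0 i)
          refine ⟨hl, ⟨fun i => Int.floor_nonneg.2 (h0 i), fun i => ?_⟩,
            fun i => Int.ceil_nonneg (h0 i), fun i => ?_⟩
          · have := (Int.floor_le _).trans (hle i)
            change ⌊(2 : ℝ) ^ dyadicLevel P W v * v i⌋ ≤ (2 : ℤ) ^ k
            exact_mod_cast this
          · refine Int.ceil_le.2 ?_
            exact_mod_cast hle i
        · rintro v ⟨hv, -⟩ w ⟨hw, -⟩ hvw
          simp only [key, Prod.mk.injEq] at hvw
          obtain ⟨h1, h2, h3⟩ := hvw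
          rw [h1] at h2 h3
          refine hVa v hv w hw ⟨hVW hv, hVW hw, ?_⟩ ⟨hVW hw, hVW hv, ?_⟩
          · exact DyadicRel.of_eq (congrFun h2) (congrFun h3)
          · rw [h1]
            exact DyadicRel.of_eq (congrFun h2.symm) (congrFun h3.symm) }
  exact hcell.isPolyhedron

end Triangulation

/-! ### Compact polyhedra as finite complexes, and the conclusion -/

/-- A compact polyhedron embeds as a subcomplex of a finite-dimensional standard simplex. -/
theorem IsPolyhedron.exists_isClosedEmbedding {Q : Type u} [TopologicalSpace Q] [CompactSpace Q]
    (hQ : IsPolyhedron Q) :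
    ∃ (ι : Type u) (_ : Fintype ι) (f : Q → ι → ℝ), IsClosedEmbedding f ∧
      (∀ q, (∀ i, 0 ≤ f q i) ∧ ∑ i, f q i = 1) ∧
      ∀ q, ∀ y : ι → ℝ, (∀ i, 0 ≤ y i) → ∑ i, y i = 1 → (∀ i, f q i = 0 → y i = 0) →
        ∃ q', f q' = y := by
  classical
  obtain ⟨V, K, ⟨e⟩⟩ := hQ
  have : CompactSpace (simplicialRealization K) := e.compactSpace
  have hvert : ∀ s ∈ K.faces, ∀ v ∈ s, {v} ∈ K.faces := fun s hs v hv =>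
    (K.isRelLowerSet_faces hs).2 (Finset.singleton_subset_iff.2 hv) (Finset.singleton_nonempty v)
  have hc : ∀ v, Continuous fun x : simplicialRealization K => (x : lp (fun _ : V => ℝ) 2) v :=
    fun v => (lp.continuous_coord v).comp continuous_subtype_val
  -- The open sets `x v > 0` cover, and a vertex lies only in its own one, so a finite subcover must
  -- list every vertex.
  have hfin : {v : V | {v} ∈ K.faces}.Finite := by
    obtain ⟨T, hT⟩ := isCompact_univ.elim_finite_subcover
      (fun v : V => {x : simplicialRealization K | 0 < (x : lp (fun _ : V => ℝ) 2) v})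
      (fun v => isOpen_lt continuous_const (hc v)) (by
        rintro ⟨x, h0, s, hs, hxs, h1⟩ -
        obtain ⟨v, hv, hxv⟩ : ∃ v ∈ s, x v ≠ 0 := by
          by_contra! hcon
          rw [Finset.sum_eq_zero hcon] at h1
          exact zero_ne_one h1
        exact Set.mem_iUnion.2 ⟨v, lt_of_le_of_ne (h0 v) hxv.symm⟩)
    refine T.finite_toSet.subset fun v hv => ?_
    have hx : lp.single (E := fun _ : V => ℝ) 2 v 1 ∈ simplicialRealization K := by
      refine ⟨fun w => ?_, {v}, hv, fun w hw => ?_, by simp⟩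
      · rw [lp.single_apply]
        by_cases hwv : w = v
        · subst hwv
          simp
        · simp [hwv]
      · rw [Finset.mem_singleton] at hw
        simp [lp.single_apply, hw]
    obtain ⟨w, hw, hvw⟩ := Set.mem_iUnion₂.1 (hT (Set.mem_univ ⟨_, hx⟩))
    have : w = v := by
      by_contra hne
      simp [lp.single_apply, hne] at hvw
    exact this ▸ hw
  have hι : Fintype {v : V // {v} ∈ K.faces} := hfin.fintype
  have hsum : ∀ (x : V → ℝ) (s : Finset V), s ∈ K.faces → (∀ v, v ∉ s → x v = 0) →
      ∑ i : {v : V // {v} ∈ K.faces}, x i = ∑ v ∈ s, x v := by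
    intro x s hs hxs
    refine (Finset.sum_subtype hfin.toFinset (fun v => hfin.mem_toFinset) x).symm.trans ?_
    refine (Finset.sum_subset (fun v hv => ?_) fun v _ hv => hxs v hv).symm
    exact hfin.mem_toFinset.2 (hvert s hs v hv)
  refine ⟨{v : V // {v} ∈ K.faces}, hι, fun q i => (e q : lp (fun _ : V => ℝ) 2) i,
    Continuous.isClosedEmbedding ?_ ?_, ?_, ?_⟩
  · exact continuous_pi fun i => (hc i).comp e.continuous
  · intro q q' h
    apply e.injective
    apply Subtype.ext
    apply lp.ext
    ext v
    by_cases hv : {v} ∈ K.faces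
    · exact congrFun h ⟨v, hv⟩
    · obtain ⟨-, s, hs, hxs, -⟩ := (e q).2
      obtain ⟨-, t, ht, hxt, -⟩ := (e q').2
      rw [hxs v fun h => hv (hvert s hs v h), hxt v fun h => hv (hvert t ht v h)]
  · intro q
    obtain ⟨h0, s, hs, hxs, h1⟩ := (e q).2
    exact ⟨fun i => h0 i, (hsum _ s hs hxs).trans h1⟩
  · intro q y hy0 hy1 hyq
    obtain ⟨h0, s, hs, hxs, h1⟩ := (e q).2
    -- Extending `y` by zero keeps its support inside the simplex `s` carrying `e q`.
    let a : V → ℝ := fun v => if h : {v} ∈ K.faces then y ⟨v, h⟩ else 0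
    have hai : ∀ i : {v : V // {v} ∈ K.faces}, a i = y i := fun i => dif_pos i.2
    have has : ∀ v, v ∉ s → a v = 0 := by
      intro v hv
      by_cases h : {v} ∈ K.faces
      · rw [hai ⟨v, h⟩]
        exact hyq _ (hxs v hv)
      · exact dif_neg h
    have hco := coe_sum_single has
    have hmem : ∑ v ∈ s, lp.single (E := fun _ : V => ℝ) 2 v (a v) ∈ simplicialRealization K := by
      refine ⟨fun v => ?_, s, hs, fun v hv => ?_, ?_⟩
      · rw [hco]
        by_cases h : {v} ∈ K.faces
        · rw [hai ⟨v, h⟩]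
          exact hy0 _
        · rw [show a v = 0 from dif_neg h]
      · rw [hco, has v hv]
      · simp only [hco]
        rw [← hsum a s hs has, ← hy1]
        exact Finset.sum_congr rfl fun i _ => hai i
    refine ⟨e.symm ⟨_, hmem⟩, ?_⟩
    ext i
    simp only [Homeomorph.apply_symm_apply]
    rw [hco, hai]

/-- Open subspaces of compact polyhedra are polyhedra. -/
theorem IsPolyhedron.of_isOpenEmbedding {Q : Type u} [TopologicalSpace Q] [CompactSpace Q]
    (hQ : IsPolyhedron Q) {Y : Type u} [TopologicalSpace Y] {j : Y → Q} (hj : IsOpenEmbedding j) :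
    IsPolyhedron Y := by
  obtain ⟨ι, _, f, hf, hf1, hf2⟩ := hQ.exists_isClosedEmbedding
  have he : IsEmbedding (f ∘ j) := hf.isEmbedding.comp hj.isEmbedding
  refine IsPolyhedron.of_homeomorph ?_ he.toHomeomorph
  refine isPolyhedron_of_relatively_open (P := Set.range f) ?_ ?_ ?_ ?_
  · rintro _ ⟨q, rfl⟩
    exact hf1 q
  · rintro _ ⟨q, rfl⟩ y h0 h1 hq
    exact hf2 q y h0 h1 hq
  · rintro _ ⟨y, rfl⟩
    exact ⟨_, rfl⟩
  · rintro _ ⟨y, rfl⟩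
    obtain ⟨O, hO, hOj⟩ := hf.isInducing.isOpen_iff.1 hj.isOpen_range
    have hy : f (j y) ∈ O := by
      change j y ∈ f ⁻¹' O
      rw [hOj]
      exact ⟨y, rfl⟩
    obtain ⟨ε, hε, hb⟩ := Metric.isOpen_iff.1 hO _ hy
    refine ⟨ε, hε, ?_⟩
    rintro _ ⟨q, rfl⟩ hd
    have hq : q ∈ f ⁻¹' O := hb hd
    rw [hOj] at hq
    obtain ⟨y', rfl⟩ := hq
    exact ⟨y', rfl⟩

theorem mainTheorem11 {Q : Type u} [TopologicalSpace Q] [CompactSpace Q]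
    (X : Set Q) (hX : LocallyCompactSpace ↥X) :
    (IsPolyhedron Q → IsCoronatedPolyhedron ↥(Xᶜ)) ∧
      (IsANR Q → IsCoronatedANR ↥(Xᶜ)) := by
  constructor
  · intro hQ
    have := hQ.metrizableSpace
    obtain ⟨K, hK, hj⟩ := exists_isCompact_isOpenEmbedding_compl X
    exact ⟨inferInstance, K, hK, hQ.of_isOpenEmbedding hj⟩
  · intro hQ
    have := hQ.1
    obtain ⟨K, hK, hj⟩ := exists_isCompact_isOpenEmbedding_compl X
    exact ⟨inferInstance, K, hK, hQ.of_isOpenEmbedding hj⟩
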